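/- Let $n\ge 1$ and let $\mathbb P_n=\{x\in\mathbb R^n : x_i\ge 0,\ \sum_i x_i=1\}$. Let $d\in\mathbb P_n$ with $d_i>0$ for all $i$, and let $d^\downarrow$ denote $d$ with its entries arranged in non-increasing order. A real $n\times n$ matrix $M$ is $d$-stochastic if its entries are nonnegative, each of its columns sums to $1$, and $Md=d$. For $1\le i<j\le n$ let $P^{d^\downarrow}(i,j)$ be the matrix that agrees with the identity except on the rows and columns $i,j$, where it equals $\begin{pmatrix}1-\gamma_{i,j}&1\\ \gamma_{i,j}&0\end{pmatrix}$ with $\gamma_{i,j}=d^\downarrow_j/d^\downarrow_i$; let $P^{d^\downarrow}(i,i)=\mathbb I$. A $d$-swap is a matrix $Q^TP^{d^\downarrow}(i,j)Q$, where $1\le i\le j\le n$ and $Q$ is a permutation matrix with $d^\downarrow=Qd$. A $T^d$-transform is a matrix $(1-\lambda)\mathbb I+\lambda P$ with $P$ a $d$-swap and $0\le\lambda\le1$. Let $\mathrm{RT}_{\mathrm{TO}}(d)$ be the set of pairs $(p,q)\in\mathbb P_n\times\mathbb P_n$ such that $q=Mp$ for some $d$-stochastic matrix $M$, and let $\mathrm{RT}_{\mathrm{WETO}}(d)$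 be the set of pairs $(p,q)\in\mathbb P_n\times\mathbb P_n$ such that $q=T_k\cdots T_1p$ for some finite sequence $T_1,\dots,T_k$ of $T^d$-transforms. Theorem (Equivalence of the TO and WETO resource theories). The following statements are equivalent: (a) $\mathrm{RT}_{\mathrm{TO}}(d)=\mathrm{RT}_{\mathrm{WETO}}(d)$. (b) $d^\downarrow=(d_0,\dots,d_0,d_1)$ for some real numbers $d_0,d_1$; that is, the first $n-1$ entries of $d^\downarrow$ are equal to each other. -/

import Mathlib

open scoped Matrix

noncomputable section

/-- `d↓`: the entries of `d` rearranged in non-increasing order. -/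
def downArrangement {n : ℕ} (d : Fin n → ℝ) : Fin n → ℝ :=
  d ∘ Tuple.sort (fun i => -d i)

theorem downArrangement_antitone {n : ℕ} (d : Fin n → ℝ) : Antitone (downArrangement d) := by
  intro i j hij
  have h := Tuple.monotone_sort (fun i => -d i) hij
  simpa [downArrangement] using h

/-- `M` is `d`-stochastic: its entries are nonnegative, its columns sum to one, and `M d = d`. -/
def IsDStochastic {n : ℕ} (d : Fin n → ℝ) (M : Matrix (Fin n) (Fin n) ℝ) : Prop :=
  M ∈ Matrix.colStochastic ℝ (Fin n) ∧ M *ᵥ d = d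

/-- For a positive vector `c` with non-increasing entries and `i < j`, the matrix that is
`!![1 - c j / c i, 1; c j / c i, 0]` on the levels `(i, j)` and the identity elsewhere.
For `i = j` it is the identity matrix. -/
def orderedSwap {n : ℕ} (c : Fin n → ℝ) (i j : Fin n) : Matrix (Fin n) (Fin n) ℝ :=
  if i = j then 1
  else Matrix.of fun k l =>
    if k = i ∧ l = i then 1 - c j / c i
    else if k = i ∧ l = j then 1
    else if k = j ∧ l = i then c j / c i
    else if k = j ∧ l = j then 0
    else if k = l then 1 else 0

/-- `P` is a `d`-swap: `P = Qᵀ P^{d↓}(i, j) Q` for some `i ≤ j` and some permutation matrix `Q`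
with `Q d = d↓`. -/
def IsDSwap {n : ℕ} (d : Fin n → ℝ) (P : Matrix (Fin n) (Fin n) ℝ) : Prop :=
  ∃ σ : Equiv.Perm (Fin n), σ.permMatrix ℝ *ᵥ d = downArrangement d ∧
    ∃ i j : Fin n, i ≤ j ∧
      P = (σ.permMatrix ℝ)ᵀ * orderedSwap (downArrangement d) i j * σ.permMatrix ℝ

/-- `T` is a `T^d`-transform: `T = (1 - t) I + t P` for a `d`-swap `P` and `0 ≤ t ≤ 1`. -/
def IsTTransform {n : ℕ} (d : Fin n → ℝ) (T : Matrix (Fin n) (Fin n) ℝ) : Prop :=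
  ∃ P : Matrix (Fin n) (Fin n) ℝ, IsDSwap d P ∧
    ∃ t : ℝ, 0 ≤ t ∧ t ≤ 1 ∧ T = (1 - t) • (1 : Matrix (Fin n) (Fin n) ℝ) + t • P

/-- The resource theory of thermal operations, as the set of transformations `(p, q)` of
probability distributions that it allows. -/
def resourceTO {n : ℕ} (d : Fin n → ℝ) : Set ((Fin n → ℝ) × (Fin n → ℝ)) :=
  {x | x.1 ∈ stdSimplex ℝ (Fin n) ∧ x.2 ∈ stdSimplex ℝ (Fin n) ∧
    ∃ M : Matrix (Fin n) (Fin n) ℝ, IsDStochastic d M ∧ x.2 = M *ᵥ x.1}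

/-- The resource theory of weak elementary thermal operations: the transformations `(p, q)` of
probability distributions realised by a finite sequence of `T^d`-transforms. -/
def resourceWETO {n : ℕ} (d : Fin n → ℝ) : Set ((Fin n → ℝ) × (Fin n → ℝ)) :=
  {x | x.1 ∈ stdSimplex ℝ (Fin n) ∧ x.2 ∈ stdSimplex ℝ (Fin n) ∧
    ∃ L : List (Matrix (Fin n) (Fin n) ℝ), (∀ T ∈ L, IsTTransform d T) ∧ x.2 = L.prod *ᵥ x.1}

end

/-! On vectors, a `T^d`-transform moves a fraction of the flow of a full swap between two levels. It
is `d`-stochastic, so WETO is always contained in TO and only the converse inclusion is at stake.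

(a) ⇒ (b), by contraposition. Let `d z ≤ d y` be the two smallest entries, let `d x > d y`, and put
`K = d y + d z`. A `d`-stochastic matrix turns `d` restricted to `{y, z}` into any vector between
`0` and `d` of total `K`, for instance one with `min (d x) K` on `x` and the rest on `y`. Such
concentration on a level heavier than `d y` cannot be created by a `T^d`-transform
(`IsConcentrated.of_transfer`), and the initial vector lacks it.

(b) ⇒ (a). All levels have weight `c` except one, `k`, with `d k ≤ c`. Thermo-majorization follows
from `d`-stochasticity: the concave curve of `p` lies above that of `q`. It is stated through
tangent lines of slope `τ`, with the excess as intercept. Sort the levels by `q i / d i`. If `p` has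
the same order, a weighted Hardy–Littlewood–Pólya argument reaches `q`
(`thermalReach_of_sum_Iic_le`). To reorder `p`, permute the equal levels freely and move `k` by full
swaps. Swapping `k` with `j` lowers the curve of `p`, but as `k` fits inside `j` it does so only
strictly between the abscissas `d(Iio j)` and `d(Iic j)`, where the curve of `q` has no vertex
(`sum_le_excess_transfer`). -/

/-! ### `T^d`-transforms as two-level transfers -/

/-- Moving the amount `δ` from level `a` to level `b`. -/
def transfer {ι : Type*} [DecidableEq ι] (v : ι → ℝ) (a b : ι) (δ : ℝ) : ι → ℝ :=
  v - Pi.single a δ + Pi.single b δ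

theorem transfer_apply {ι : Type*} [DecidableEq ι] (v : ι → ℝ) (a b : ι) (δ : ℝ) (w : ι) :
    transfer v a b δ w = v w - (if w = a then δ else 0) + (if w = b then δ else 0) := by
  simp [transfer, Pi.single_apply]

theorem transfer_self {ι : Type*} [DecidableEq ι] (v : ι → ℝ) (a : ι) (δ : ℝ) :
    transfer v a a δ = v := by
  simp [transfer]

theorem sum_transfer {ι : Type*} [DecidableEq ι] (s : Finset ι) (v : ι → ℝ) (a b : ι) (δ : ℝ) :
    ∑ i ∈ s, transfer v a b δ i =
      ∑ i ∈ s, v i - (if a ∈ s then δ else 0) + (if b ∈ s then δ else 0) := by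
  simp [transfer_apply, Finset.sum_add_distrib, Finset.sum_sub_distrib]

theorem orderedSwap_mulVec {n : ℕ} (c : Fin n → ℝ) (i j : Fin n) (u : Fin n → ℝ) :
    orderedSwap c i j *ᵥ u = transfer u i j (c j / c i * u i - u j) := by
  by_cases hij : i = j
  · simp [orderedSwap, hij, transfer_self]
  have key : ∀ k l, orderedSwap c i j k l = (if k = l then 1 else 0)
      + (if l = i then c j / c i * ((if k = j then 1 else 0) - (if k = i then 1 else 0)) else 0)
      + (if l = j then ((if k = i then 1 else 0) - (if k = j then 1 else 0)) else 0) := by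
    intro k l
    simp only [orderedSwap, hij, if_false, Matrix.of_apply]
    grind
  ext k
  simp only [Matrix.mulVec, dotProduct, key, transfer_apply, add_mul, Finset.sum_add_distrib,
    ite_mul, one_mul, zero_mul, Finset.sum_ite_eq, Finset.sum_ite_eq', Finset.mem_univ, if_true]
  split_ifs <;> ring

theorem conj_orderedSwap_mulVec {n : ℕ} (c : Fin n → ℝ) (σ : Equiv.Perm (Fin n)) (i j : Fin n)
    (v : Fin n → ℝ) :
    ((σ.permMatrix ℝ)ᵀ * orderedSwap c i j * σ.permMatrix ℝ) *ᵥ v =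
      transfer v (σ i) (σ j) (c j / c i * v (σ i) - v (σ j)) := by
  rw [← Matrix.mulVec_mulVec, ← Matrix.mulVec_mulVec, Matrix.permMatrix_mulVec,
    orderedSwap_mulVec, Matrix.transpose_permMatrix, Matrix.permMatrix_mulVec]
  ext w
  simp [transfer_apply, Equiv.symm_apply_eq]

theorem IsTTransform.exists_transfer {n : ℕ} {d : Fin n → ℝ} {T : Matrix (Fin n) (Fin n) ℝ}
    (hT : IsTTransform d T) :
    ∃ a b : Fin n, d b ≤ d a ∧ ∃ t : ℝ, 0 ≤ t ∧ t ≤ 1 ∧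
      ∀ v, T *ᵥ v = transfer v a b (t * (d b / d a * v a - v b)) := by
  obtain ⟨P, ⟨σ, hσ, i, j, hij, rfl⟩, t, ht0, ht1, rfl⟩ := hT
  rw [Matrix.permMatrix_mulVec] at hσ
  have hd : ∀ l, downArrangement d l = d (σ l) := fun l => (congrFun hσ l).symm
  refine ⟨σ i, σ j, ?_, t, ht0, ht1, fun v => ?_⟩
  · rw [← hd, ← hd]
    exact downArrangement_antitone d hij
  · rw [Matrix.add_mulVec, Matrix.smul_mulVec, Matrix.smul_mulVec, Matrix.one_mulVec,
      conj_orderedSwap_mulVec, hd, hd]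
    ext w
    simp only [transfer_apply, Pi.add_apply, Pi.smul_apply, smul_eq_mul]
    split_ifs <;> ring

/-- The sorting permutation can only misplace `a` and `b` if `d a = d b`, and then exchanging them
keeps `d` sorted. Hence every pair with `d b ≤ d a` carries a `d`-swap, ties included. -/
theorem exists_perm_eq_downArrangement {n : ℕ} (d : Fin n → ℝ) (a b : Fin n) (h : d b ≤ d a) :
    ∃ σ : Equiv.Perm (Fin n), d ∘ σ = downArrangement d ∧ σ.symm a ≤ σ.symm b := by
  set σ : Equiv.Perm (Fin n) := Tuple.sort (fun i => -d i) with hσ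
  rcases le_total (σ.symm a) (σ.symm b) with hab | hab
  · exact ⟨σ, rfl, hab⟩
  · have hanti := downArrangement_antitone d hab
    have hval : ∀ l, downArrangement d (σ.symm l) = d l := fun l => by
      simp [downArrangement, ← hσ]
    rw [hval, hval] at hanti
    have heq : d a = d b := le_antisymm hanti h
    refine ⟨σ.trans (Equiv.swap a b), ?_, ?_⟩
    · ext l
      simp only [Function.comp, Equiv.trans_apply, downArrangement, ← hσ]
      rcases eq_or_ne (σ l) a with h1 | h1
      · rw [h1, Equiv.swap_apply_left, heq]
      rcases eq_or_ne (σ l) b with h2 | h2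
      · rw [h2, Equiv.swap_apply_right, heq]
      rw [Equiv.swap_apply_of_ne_of_ne h1 h2]
    · simpa using hab

theorem exists_isTTransform {n : ℕ} (d : Fin n → ℝ) (a b : Fin n) (h : d b ≤ d a) (t : ℝ)
    (ht0 : 0 ≤ t) (ht1 : t ≤ 1) :
    ∃ T, IsTTransform d T ∧ ∀ v, T *ᵥ v = transfer v a b (t * (d b / d a * v a - v b)) := by
  obtain ⟨σ, hσ, hab⟩ := exists_perm_eq_downArrangement d a b h
  refine ⟨_, ⟨_, ⟨σ, by rw [Matrix.permMatrix_mulVec, hσ], σ.symm a, σ.symm b, hab, rfl⟩,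
    t, ht0, ht1, rfl⟩, fun v => ?_⟩
  rw [Matrix.add_mulVec, Matrix.smul_mulVec, Matrix.smul_mulVec, Matrix.one_mulVec,
    conj_orderedSwap_mulVec, ← hσ]
  ext w
  simp only [transfer_apply, Pi.add_apply, Pi.smul_apply, smul_eq_mul, Function.comp,
    Equiv.apply_symm_apply]
  split_ifs <;> ring

/-- The amount moved by a `T^d`-transform keeps nonnegative vectors nonnegative. -/
theorem transfer_nonneg {ι : Type*} [DecidableEq ι] {d v : ι → ℝ} (hd : ∀ i, 0 < d i)
    (hv : ∀ i, 0 ≤ v i) {a b : ι} (hab : d b ≤ d a) {t : ℝ} (ht0 : 0 ≤ t) (ht1 : t ≤ 1) (i : ι) :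
    0 ≤ transfer v a b (t * (d b / d a * v a - v b)) i := by
  have hγ0 : 0 ≤ d b / d a := (div_pos (hd b) (hd a)).le
  have hγ1 : d b / d a ≤ 1 := (div_le_one (hd a)).2 hab
  have ha := hv a
  have hb := hv b
  have h1 : 0 ≤ t * (d b / d a * v a) := by positivity
  have h2 : t * (d b / d a * v a) ≤ v a := by
    have : d b / d a * v a ≤ v a := mul_le_of_le_one_left ha hγ1
    exact (mul_le_of_le_one_left (by positivity) ht1).trans this
  have h3 : 0 ≤ t * v b := by positivity
  have h4 : t * v b ≤ v b := mul_le_of_le_one_left hb ht1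
  have := hv i
  rw [transfer_apply]
  split_ifs with h5 h6 h6 <;> subst_vars <;> nlinarith

theorem isDStochastic_of_mulVec {n : ℕ} {d : Fin n → ℝ} {M : Matrix (Fin n) (Fin n) ℝ}
    (h0 : ∀ v : Fin n → ℝ, (∀ i, 0 ≤ v i) → ∀ i, 0 ≤ (M *ᵥ v) i)
    (h1 : ∀ v : Fin n → ℝ, ∑ i, (M *ᵥ v) i = ∑ i, v i) (hd : M *ᵥ d = d) :
    IsDStochastic d M := by
  refine ⟨Matrix.mem_colStochastic_iff_sum.2 ⟨fun i j => ?_, fun j => ?_⟩, hd⟩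
  · simpa using h0 (Pi.single j 1) (fun k => by by_cases h : k = j <;> simp [h]) i
  · simpa using h1 (Pi.single j 1)

theorem IsTTransform.isDStochastic {n : ℕ} {d : Fin n → ℝ} (hpos : ∀ i, 0 < d i)
    {T : Matrix (Fin n) (Fin n) ℝ} (hT : IsTTransform d T) : IsDStochastic d T := by
  obtain ⟨a, b, hab, t, ht0, ht1, h⟩ := hT.exists_transfer
  refine isDStochastic_of_mulVec (fun v hv i => ?_) (fun v => ?_) ?_
  · rw [h]
    exact transfer_nonneg hpos hv hab ht0 ht1 i
  · rw [h, sum_transfer]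
    simp
  · rw [h, div_mul_cancel₀ _ (hpos a).ne']
    ext i
    simp [transfer_apply]

theorem IsDStochastic.one {n : ℕ} (d : Fin n → ℝ) : IsDStochastic d 1 :=
  ⟨one_mem _, Matrix.one_mulVec d⟩

theorem IsDStochastic.mul {n : ℕ} {d : Fin n → ℝ} {M N : Matrix (Fin n) (Fin n) ℝ}
    (hM : IsDStochastic d M) (hN : IsDStochastic d N) : IsDStochastic d (M * N) :=
  ⟨mul_mem hM.1 hN.1, by rw [← Matrix.mulVec_mulVec, hN.2, hM.2]⟩

theorem IsDStochastic.list_prod {n : ℕ} {d : Fin n → ℝ} (L : List (Matrix (Fin n) (Fin n) ℝ))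
    (h : ∀ T ∈ L, IsDStochastic d T) : IsDStochastic d L.prod := by
  induction L with
  | nil => exact IsDStochastic.one d
  | cons T L ih =>
    rw [List.prod_cons]
    exact (h T (by simp)).mul (ih fun S hS => h S (by simp [hS]))

theorem resourceWETO_subset_resourceTO {n : ℕ} {d : Fin n → ℝ} (hpos : ∀ i, 0 < d i) :
    resourceWETO d ⊆ resourceTO d := by
  rintro ⟨p, q⟩ ⟨hp, hq, L, hL, h⟩
  exact ⟨hp, hq, L.prod, IsDStochastic.list_prod L fun T hT => (hL T hT).isDStochastic hpos, h⟩

/-! ### Concentration as an obstruction -/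

/-- `v` has one level `i` with `d i > m` that is filled up as far as the total `K` permits, and at
most one further occupied level. -/
def IsConcentrated {ι : Type*} (d : ι → ℝ) (m K : ℝ) (v : ι → ℝ) : Prop :=
  ∃ i j, i ≠ j ∧ m < d i ∧ v i = min (d i) K ∧ ∀ w, w ≠ i → w ≠ j → v w = 0

theorem add_le_sum_of_ne {ι : Type*} [Fintype ι] [DecidableEq ι] {v : ι → ℝ} (hv : ∀ i, 0 ≤ v i)
    {a b : ι} (hab : a ≠ b) : v a + v b ≤ ∑ i, v i := by
  rw [← Finset.sum_pair hab]
  exact Finset.sum_le_sum_of_subset_of_nonneg (Finset.subset_univ _) fun i _ _ => hv i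

theorem eq_zero_of_eq_sum {ι : Type*} [Fintype ι] [DecidableEq ι] {v : ι → ℝ} (hv : ∀ i, 0 ≤ v i)
    {a b : ι} (ha : ∑ i, v i ≤ v a) (hb : b ≠ a) : v b = 0 :=
  le_antisymm (by linarith [add_le_sum_of_ne hv hb]) (hv b)

/-- Concentration cannot be created by a full `d`-swap. -/
theorem IsConcentrated.of_swap {ι : Type*} [Fintype ι] [DecidableEq ι] {d v : ι → ℝ} {m l : ℝ}
    (hl : 0 < l) (hld : ∀ i, l ≤ d i) (hv0 : ∀ i, 0 ≤ v i) (hvd : ∀ i, v i ≤ d i)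
    (hsum : ∑ i, v i = m + l) {a b : ι} (hab : d b ≤ d a)
    (h : IsConcentrated d m (m + l) (transfer v a b (d b / d a * v a - v b))) :
    IsConcentrated d m (m + l) v := by
  rcases eq_or_ne a b with rfl | hne
  · rwa [transfer_self] at h
  have hd : ∀ i, 0 < d i := fun i => hl.trans_le (hld i)
  obtain ⟨i, j, hij, hi, hui, huw⟩ := h
  have hu0 : ∀ w, 0 ≤ transfer v a b (d b / d a * v a - v b) w := fun w => by
    simpa using transfer_nonneg hd hv0 hab zero_le_one le_rfl w
  have husum : ∑ w, transfer v a b (d b / d a * v a - v b) w = m + l := by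
    rw [sum_transfer]
    simpa using hsum
  have hγ0 : 0 < d b / d a := div_pos (hd b) (hd a)
  have hγ1 : d b / d a ≤ 1 := (div_le_one (hd a)).2 hab
  have hγ : d b / d a * d a = d b := div_mul_cancel₀ _ (hd a).ne'
  have hua : transfer v a b (d b / d a * v a - v b) a = (1 - d b / d a) * v a + v b := by
    simp only [transfer_apply, if_true, hne, if_false]
    ring
  have hub : transfer v a b (d b / d a * v a - v b) b = d b / d a * v a := by
    simp only [transfer_apply, if_true, hne.symm, if_false]
    ring
  have huc : ∀ w, w ≠ a → w ≠ b → transfer v a b (d b / d a * v a - v b) w = v w := by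
    intro w h1 h2
    simp [transfer_apply, h1, h2]
  generalize d b / d a = γ at *
  generalize transfer v a b (γ * v a - v b) = u at *
  have hvK : ∀ w, v w ≤ m + l := fun w => by
    rw [← hsum]
    exact Finset.single_le_sum (fun i _ => hv0 i) (Finset.mem_univ w)
  have hmul : 0 ≤ (1 - γ) * v a := mul_nonneg (by linarith) (hv0 a)
  have hmul_b : 0 ≤ (1 - γ) * d a := mul_nonneg (by linarith) (hd a).le
  have hzero : u a = 0 → v b = 0 := fun h => by linarith [hv0 b]
  have hzero_b : u b = 0 → v a = 0 := fun h => by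
    rw [hub] at h
    exact (mul_eq_zero.1 h).resolve_left hγ0.ne'
  rcases eq_or_ne b i with rfl | hbi
  · rcases le_or_gt (m + l) (d b) with hK | hK
    · rw [min_eq_right hK, hub] at hui
      -- The total is `m + l` and `γ ≤ 1`, so `γ * v a = m + l` forces all of it onto `a`.
      have h1 : v a = m + l := by nlinarith [hvK a, hv0 a]
      refine ⟨a, b, hne, hi.trans_le hab, by rw [h1, min_eq_right (hK.trans hab)], ?_⟩
      exact fun w hwa _ => eq_zero_of_eq_sum hv0 (by rw [hsum, h1]) hwa
    · rw [min_eq_left hK.le, hub, ← hγ] at hui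
      have h1 : v a = d a := mul_left_cancel₀ hγ0.ne' hui
      have h2 : v a = min (d a) (m + l) := by rw [← h1, min_eq_left (hvK a)]
      rcases eq_or_ne a j with rfl | haj
      · refine ⟨a, b, hne, hi.trans_le hab, h2, fun w h3 h4 => ?_⟩
        rw [← huc w h3 h4, huw w h4 h3]
      · refine ⟨a, j, haj, hi.trans_le hab, h2, fun w h3 h4 => ?_⟩
        rcases eq_or_ne w b with rfl | h5
        · exact hzero (huw a hne haj)
        · rw [← huc w h3 h5, huw w h5 h4]
  rcases eq_or_ne a i with rfl | hai
  · rcases le_or_gt (m + l) (d a) with hK | hK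
    · rw [min_eq_right hK] at hui
      have h1 : v a = 0 := hzero_b (eq_zero_of_eq_sum hu0 (by rw [husum, hui]) hbi)
      have h2 : v b = m + l := by rw [hua, h1] at hui; linarith
      have h3 : m + l ≤ d b := h2 ▸ hvd b
      refine ⟨b, a, hbi, by linarith, by rw [h2, min_eq_right h3], fun w hw _ => ?_⟩
      exact eq_zero_of_eq_sum hv0 (by rw [hsum, h2]) hw
    · rw [min_eq_left hK.le, hua] at hui
      have h1 : (1 - γ) * v a ≤ (1 - γ) * d a :=
        mul_le_mul_of_nonneg_left (hvd a) (by linarith)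
      -- Filling `a` completely leaves no slack in `v a ≤ d a` (unless `γ = 1`) or in `v b ≤ d b`.
      have h2 : v b = d b := by linarith [hvd b]
      have h3 : (1 - γ) * (d a - v a) = 0 := by linarith
      have hgam : γ = 1 → d b = d a ∧ v b = min (d b) (m + l) := fun h => by
        rw [h, one_mul] at hγ
        exact ⟨hγ.symm, by rw [← h2, min_eq_left (hvK b)]⟩
      rcases eq_or_ne b j with rfl | hbj
      · rcases mul_eq_zero.1 h3 with h4 | h4
        · obtain ⟨h5, h6⟩ := hgam (by linarith)
          refine ⟨b, a, hbi, h5 ▸ hi, h6, fun w h7 h8 => ?_⟩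
          rw [← huc w h8 h7, huw w h8 h7]
        -- Two full levels would hold `d a + d b > m + l`; this is why the total is taken to be `m +
        -- l`.
        · have := add_le_sum_of_ne hv0 hne
          linarith [hld b]
      · have h4 : v a = 0 := hzero_b (huw b hbi hbj)
        obtain ⟨h5, h6⟩ := hgam (by
          rw [h4, sub_zero] at h3
          linarith [(mul_eq_zero.1 h3).resolve_right (hd a).ne'])
        refine ⟨b, j, hbj, h5 ▸ hi, h6, fun w h7 h8 => ?_⟩
        rcases eq_or_ne w a with rfl | h9
        · exact h4
        · rw [← huc w h9 h7, huw w h9 h8]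
  -- The swap misses `i`. Emptiness of `a` after it gives emptiness of `b` before it, and vice
  -- versa, so the second occupied level is at most relabelled.
  rw [huc i hai.symm hbi.symm] at hui
  rcases eq_or_ne a j with rfl | haj
  · refine ⟨i, b, hbi.symm, hi, hui, fun w h1 h2 => ?_⟩
    rcases eq_or_ne w a with rfl | h3
    · exact hzero_b (huw b hbi hne.symm)
    · rw [← huc w h3 h2, huw w h1 h3]
  rcases eq_or_ne b j with rfl | hbj
  · refine ⟨i, a, hai.symm, hi, hui, fun w h1 h2 => ?_⟩
    rcases eq_or_ne w b with rfl | h3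
    · exact hzero (huw a hai haj)
    · rw [← huc w h2 h3, huw w h1 h3]
  refine ⟨i, j, hij, hi, hui, fun w h1 h2 => ?_⟩
  rcases eq_or_ne w a with rfl | h3
  · exact hzero_b (huw b hbi hbj)
  rcases eq_or_ne w b with rfl | h4
  · exact hzero (huw a hai haj)
  rw [← huc w h3 h4, huw w h1 h2]

/-- Concentration cannot be created by a `T^d`-transform. -/
theorem IsConcentrated.of_transfer {ι : Type*} [Fintype ι] [DecidableEq ι] {d v : ι → ℝ} {m l : ℝ}
    (hl : 0 < l) (hld : ∀ i, l ≤ d i) (hv0 : ∀ i, 0 ≤ v i) (hvd : ∀ i, v i ≤ d i)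
    (hsum : ∑ i, v i = m + l) {a b : ι} (hab : d b ≤ d a) {t : ℝ} (ht0 : 0 ≤ t) (ht1 : t ≤ 1)
    (h : IsConcentrated d m (m + l) (transfer v a b (t * (d b / d a * v a - v b)))) :
    IsConcentrated d m (m + l) v := by
  have hd : ∀ i, 0 < d i := fun i => hl.trans_le (hld i)
  rcases ht1.eq_or_lt with rfl | ht1'
  · rw [one_mul] at h
    exact h.of_swap hl hld hv0 hvd hsum hab
  have hu0 : ∀ w, 0 ≤ transfer v a b (d b / d a * v a - v b) w := fun w => by
    simpa using transfer_nonneg hd hv0 hab zero_le_one le_rfl w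
  have hud : ∀ w, transfer v a b (d b / d a * v a - v b) w ≤ d w := fun w => by
    -- The swap fixes `d`, so the upper bound is positivity applied to `d - v`.
    have := transfer_nonneg (v := d - v) hd (fun i => sub_nonneg.2 (hvd i)) hab zero_le_one le_rfl w
    have h3 := div_mul_cancel₀ (d b) (hd a).ne'
    simp only [transfer_apply, Pi.sub_apply, one_mul, mul_sub, h3] at this ⊢
    split_ifs at this ⊢ <;> linarith
  have husum : ∑ w, transfer v a b (d b / d a * v a - v b) w = m + l := by
    rw [sum_transfer]
    simpa using hsum
  have huK : ∀ w, transfer v a b (d b / d a * v a - v b) w ≤ m + l := fun w => by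
    rw [← husum]
    exact Finset.single_le_sum (fun i _ => hu0 i) (Finset.mem_univ w)
  have hvK : ∀ w, v w ≤ m + l := fun w => by
    rw [← hsum]
    exact Finset.single_le_sum (fun i _ => hv0 i) (Finset.mem_univ w)
  have hmix : ∀ w, transfer v a b (t * (d b / d a * v a - v b)) w =
      (1 - t) * v w + t * transfer v a b (d b / d a * v a - v b) w := fun w => by
    simp only [transfer_apply]
    split_ifs <;> ring
  obtain ⟨i, j, hij, hi, hui, huw⟩ := h
  refine ⟨i, j, hij, hi, ?_, fun w hwi hwj => ?_⟩
  · rw [hmix] at hui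
    have h1 : v i ≤ min (d i) (m + l) := le_min (hvd i) (hvK i)
    have h2 := le_min (hud i) (huK i)
    -- A convex combination with positive weight `1 - t` on `v` attains a common bound only if `v`
    -- does; the zeros below use the same argument.
    nlinarith [mul_le_mul_of_nonneg_left h2 ht0]
  · have h1 := huw w hwi hwj
    rw [hmix] at h1
    have h2 := mul_nonneg ht0 (hu0 w)
    have h3 : (1 - t) * v w = 0 :=
      le_antisymm (by linarith) (mul_nonneg (by linarith) (hv0 w))
    exact (mul_eq_zero.1 h3).resolve_left (by linarith)

theorem IsConcentrated.of_list_prod {n : ℕ} {d v : Fin n → ℝ} {m l : ℝ}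
    (hl : 0 < l) (hld : ∀ i, l ≤ d i) (hv0 : ∀ i, 0 ≤ v i) (hvd : ∀ i, v i ≤ d i)
    (hsum : ∑ i, v i = m + l) (L : List (Matrix (Fin n) (Fin n) ℝ))
    (hL : ∀ T ∈ L, IsTTransform d T) (h : IsConcentrated d m (m + l) (L.prod *ᵥ v)) :
    IsConcentrated d m (m + l) v := by
  have hd : ∀ i, 0 < d i := fun i => hl.trans_le (hld i)
  induction L with
  | nil => simpa using h
  | cons T L ih =>
    have hL' : ∀ S ∈ L, IsTTransform d S := fun S hS => hL S (by simp [hS])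
    obtain ⟨a, b, hab, t, ht0, ht1, hT⟩ := (hL T (by simp)).exists_transfer
    have hS : IsDStochastic d L.prod :=
      IsDStochastic.list_prod L fun S hS => (hL' S hS).isDStochastic hd
    rw [List.prod_cons, ← Matrix.mulVec_mulVec, hT] at h
    refine ih hL' (h.of_transfer hl hld
      (Matrix.nonneg_mulVec_of_mem_colStochastic hS.1 hv0) (fun i => ?_) ?_ hab ht0 ht1)
    · have h1 := Matrix.nonneg_mulVec_of_mem_colStochastic hS.1
        (x := d - v) (fun i => sub_nonneg.2 (hvd i)) i
      rw [Matrix.mulVec_sub, hS.2] at h1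
      simpa using h1
    · rw [Matrix.sum_mulVec_of_mem_colStochastic hS.1, hsum]

/-! ### A transformation in TO but not in WETO -/

/-- Spreading the vector `q` over the levels of `B` and `d - q` over the remaining levels. -/
theorem exists_isDStochastic_mulVec_indicator {n : ℕ} {d q : Fin n → ℝ} (hd : ∑ i, d i = 1)
    {B : Finset (Fin n)} {K : ℝ} (hK0 : 0 < K) (hK1 : K < 1) (hB : ∑ i ∈ B, d i = K)
    (hq0 : ∀ i, 0 ≤ q i) (hqd : ∀ i, q i ≤ d i) (hq : ∑ i, q i = K) :
    ∃ M, IsDStochastic d M ∧ M *ᵥ (fun i => if i ∈ B then d i else 0) = q := by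
  have hK1' : 0 < 1 - K := by linarith
  refine ⟨Matrix.of fun i j => if j ∈ B then q i / K else (d i - q i) / (1 - K),
    ⟨Matrix.mem_colStochastic_iff_sum.2 ⟨fun i j => ?_, fun j => ?_⟩, ?_⟩, ?_⟩
  · have h1 := div_nonneg (hq0 i) hK0.le
    have h2 := div_nonneg (sub_nonneg.2 (hqd i)) hK1'.le
    simp only [Matrix.of_apply]
    split_ifs <;> assumption
  · simp only [Matrix.of_apply]
    split_ifs
    · rw [← Finset.sum_div, hq, div_self hK0.ne']
    · rw [← Finset.sum_div, Finset.sum_sub_distrib, hd, hq, div_self hK1'.ne']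
  · ext i
    have hBc : ∑ j ∈ Bᶜ, d j = 1 - K := by
      rw [← hd, ← hB, ← Finset.sum_add_sum_compl B]
      ring
    simp only [Matrix.mulVec, dotProduct, Matrix.of_apply]
    rw [← Finset.sum_add_sum_compl B,
      Finset.sum_congr rfl (g := fun j => q i / K * d j) fun j hj => by rw [if_pos hj],
      Finset.sum_congr rfl (s₁ := Bᶜ) (g := fun j => (d i - q i) / (1 - K) * d j) fun j hj => by
        rw [if_neg (Finset.mem_compl.1 hj)],
      ← Finset.mul_sum, ← Finset.mul_sum, hB, hBc, div_mul_cancel₀ _ hK0.ne',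
      div_mul_cancel₀ _ hK1'.ne']
    ring
  · ext i
    simp only [Matrix.mulVec, dotProduct, Matrix.of_apply, mul_ite, mul_zero]
    rw [← Finset.sum_filter, Finset.filter_mem_eq_inter, Finset.univ_inter,
      Finset.sum_congr rfl (g := fun j => q i / K * d j) fun j hj => by rw [if_pos hj],
      ← Finset.mul_sum, hB, div_mul_cancel₀ _ hK0.ne']

theorem resourceTO_ne_resourceWETO {n : ℕ} {d : Fin n → ℝ} (hd : ∑ i, d i = 1)
    {x y z : Fin n} (hxy : d y < d x) (hzy : z ≠ y) (hxz : x ≠ z) (hz : 0 < d z)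
    (hmin : ∀ i, d z ≤ d i) (hmin' : ∀ i, i ≠ z → d y ≤ d i) :
    resourceTO d ≠ resourceWETO d := by
  have hpos : ∀ i, 0 < d i := fun i => hz.trans_le (hmin i)
  have hxy' : x ≠ y := fun h => hxy.ne (h ▸ rfl)
  have hzy' := hmin y
  have hy := hpos y
  set K := d y + d z with hK
  have hK0 : 0 < K := by positivity
  set B : Finset (Fin n) := {y, z} with hBdef
  have hB : ∑ i ∈ B, d i = K := Finset.sum_pair hzy.symm
  have hK1 : K < 1 := by
    have h1 : ∑ i ∈ insert x B, d i ≤ 1 := by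
      rw [← hd]
      exact Finset.sum_le_sum_of_subset_of_nonneg (Finset.subset_univ _) fun i _ _ => (hpos i).le
    rw [Finset.sum_insert (by simp [hBdef, hxy', hxz]), hB] at h1
    linarith [hpos x]
  set p : Fin n → ℝ := fun i => if i ∈ B then d i else 0 with hp
  have hp0 : ∀ i, 0 ≤ p i := fun i => by
    simp only [hp]
    split_ifs
    exacts [(hpos i).le, le_rfl]
  have hpd : ∀ i, p i ≤ d i := fun i => by
    simp only [hp]
    split_ifs
    exacts [le_rfl, (hpos i).le]
  have hpsum : ∑ i, p i = K := by
    simp only [hp]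
    rw [← Finset.sum_filter, Finset.filter_mem_eq_inter, Finset.univ_inter, hB]
  set q : Fin n → ℝ := fun i =>
    if i = x then min (d x) K else if i = y then K - min (d x) K else 0 with hq
  have hq0 : ∀ i, 0 ≤ q i := fun i => by
    simp only [hq]
    split_ifs
    exacts [le_min (hpos x).le hK0.le, sub_nonneg.2 (min_le_right _ _), le_rfl]
  have hqd : ∀ i, q i ≤ d i := fun i => by
    simp only [hq]
    split_ifs with h1 h2
    · rw [h1]
      exact min_le_left _ _
    · rw [h2]
      rcases min_cases (d x) K with h | h <;> linarith
    · exact (hpos i).le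
  have hqsum : ∑ i, q i = K := by
    have h1 : ∑ i ∈ ({x, y} : Finset (Fin n)), q i = ∑ i, q i := by
      refine Finset.sum_subset (Finset.subset_univ _) fun i _ hi => ?_
      simp only [Finset.mem_insert, Finset.mem_singleton, not_or] at hi
      simp [hq, hi.1, hi.2]
    rw [← h1, Finset.sum_pair hxy']
    simp [hq, hxy'.symm]
  obtain ⟨M, hM, hMp⟩ := exists_isDStochastic_mulVec_indicator hd hK0 hK1 hB hq0 hqd hqsum
  have hsimplex : ∀ v : Fin n → ℝ, (∀ i, 0 ≤ v i) → ∑ i, v i = K →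
      K⁻¹ • v ∈ stdSimplex ℝ (Fin n) := fun v h0 h1 => by
    refine ⟨fun i => mul_nonneg (inv_nonneg.2 hK0.le) (h0 i), ?_⟩
    simp only [Pi.smul_apply, smul_eq_mul]
    rw [← Finset.mul_sum, h1, inv_mul_cancel₀ hK0.ne']
  intro heq
  have hmem : (K⁻¹ • p, K⁻¹ • q) ∈ resourceTO d :=
    ⟨hsimplex p hp0 hpsum, hsimplex q hq0 hqsum, M, hM, by
      simp only
      rw [Matrix.mulVec_smul, hMp]⟩
  rw [heq] at hmem
  obtain ⟨-, -, L, hL, h⟩ := hmem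
  simp only at h
  rw [Matrix.mulVec_smul] at h
  have hLp : q = L.prod *ᵥ p := smul_right_injective _ (inv_ne_zero hK0.ne') h
  have hcq : IsConcentrated d (d y) (d y + d z) (L.prod *ᵥ p) := by
    rw [← hLp]
    refine ⟨x, y, hxy', hxy, by simp [hq, hK], fun w h1 h2 => by simp [hq, h1, h2]⟩
  obtain ⟨i, -, -, hi, hpi, -⟩ := hcq.of_list_prod hz hmin hp0 hpd hpsum L hL
  -- Concentration of `p` would require an entry `min (d i) K > d y`.
  have h1 : p i ≤ d y := by
    simp only [hp, hBdef]
    split_ifs with h2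
    · rcases Finset.mem_insert.1 h2 with rfl | h2
      · exact le_rfl
      · rw [Finset.mem_singleton.1 h2]
        exact hzy'
    · exact hy.le
  rw [hpi] at h1
  rcases min_cases (d i) (d y + d z) with h | h <;> linarith

theorem downArrangement_eq_of_resourceTO_eq {n : ℕ} {d : Fin n → ℝ} (hd : ∑ i, d i = 1)
    (hpos : ∀ i, 0 < d i) (h : resourceTO d = resourceWETO d) :
    ∃ d₀ d₁ : ℝ, ∀ k : Fin n, downArrangement d k = if (k : ℕ) + 1 = n then d₁ else d₀ := by
  rcases Nat.lt_or_ge n 2 with hn | hn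
  · rcases Nat.eq_zero_or_pos n with rfl | hn0
    · exact ⟨0, 0, fun k => k.elim0⟩
    -- For `n = 1` the only entry is the last one, so `d₀` is arbitrary.
    · refine ⟨0, downArrangement d ⟨0, hn0⟩, fun k => ?_⟩
      rw [if_pos (by omega), show k = ⟨0, hn0⟩ from Fin.ext (by simp; omega)]
  refine ⟨downArrangement d ⟨0, by omega⟩, downArrangement d ⟨n - 1, by omega⟩, fun k => ?_⟩
  split_ifs with hk
  · congr 1
    exact Fin.ext (by simp; omega)
  have hanti := downArrangement_antitone d
  refine le_antisymm (hanti (Fin.mk_le_mk.2 (by omega))) ?_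
  by_contra! hlt
  set σ : Equiv.Perm (Fin n) := Tuple.sort (fun i => -d i) with hσ
  have hdn : ∀ l, downArrangement d l = d (σ l) := fun l => rfl
  have hle : ∀ (l : Fin n) i, (σ.symm i) ≤ l → d (σ l) ≤ d i := fun l i hl => by
    simpa [hdn] using hanti hl
  refine resourceTO_ne_resourceWETO hd (x := σ ⟨0, by omega⟩) (y := σ ⟨n - 2, by omega⟩)
    (z := σ ⟨n - 1, by omega⟩) ?_ ?_ ?_ (hpos _) (fun i => hle _ i ?_) (fun i hi => hle _ i ?_) h
  · rw [← hdn, ← hdn]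
    exact (hanti (Fin.mk_le_mk.2 (by omega))).trans_lt hlt
  · rw [σ.injective.ne_iff, Ne, Fin.mk.injEq]
    omega
  · rw [σ.injective.ne_iff, Ne, Fin.mk.injEq]
    omega
  · rw [Fin.le_def]
    simp only
    omega
  · rw [Ne, ← Equiv.symm_apply_eq, Fin.ext_iff] at hi
    rw [Fin.le_def]
    simp only at hi ⊢
    omega

/-! ### Reachability by two-level moves -/

/-- A two-level move: the amount `δ` flows from level `a` to level `b` without overshooting the
full swap of the two levels. -/
def ThermalMove {ι : Type*} [DecidableEq ι] (d v v' : ι → ℝ) : Prop :=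
  ∃ a b δ, 0 ≤ δ ∧ δ * d a ≤ d b * v a - d a * v b ∧ δ * d b ≤ d b * v a - d a * v b ∧
    v' = transfer v a b δ

/-- Reachability by finitely many two-level moves. -/
def ThermalReach {ι : Type*} [DecidableEq ι] (d : ι → ℝ) : (ι → ℝ) → (ι → ℝ) → Prop :=
  Relation.ReflTransGen (ThermalMove d)

/-- The mixing parameter is `δ` divided by the full-swap flow, and the bound on `δ` from the heavier
level makes it at most one. If that flow vanishes, so does `δ`. -/
theorem ThermalMove.exists_mulVec {n : ℕ} {d v v' : Fin n → ℝ} (hd : ∀ i, 0 < d i)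
    (h : ThermalMove d v v') : ∃ T, IsTTransform d T ∧ v' = T *ᵥ v := by
  obtain ⟨a, b, δ, h0, ha, hb, rfl⟩ := h
  rcases le_total (d b) (d a) with hab | hab
  · have hX : δ ≤ d b / d a * v a - v b := by
      have h1 : δ ≤ (d b * v a - d a * v b) / d a := (le_div_iff₀ (hd a)).2 ha
      have h2 : (d b * v a - d a * v b) / d a = d b / d a * v a - v b := by
        field_simp [(hd a).ne']
      linarith
    obtain ⟨T, hT, hTv⟩ := exists_isTTransform d a b hab (δ / (d b / d a * v a - v b))
      (div_nonneg h0 (h0.trans hX)) (div_le_one_of_le₀ hX (h0.trans hX))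
    refine ⟨T, hT, ?_⟩
    rw [hTv, div_mul_cancel_of_imp fun h => le_antisymm (hX.trans h.le) h0]
  · have hX : δ ≤ v a - d a / d b * v b := by
      have h1 : δ ≤ (d b * v a - d a * v b) / d b := (le_div_iff₀ (hd b)).2 hb
      have h2 : (d b * v a - d a * v b) / d b = v a - d a / d b * v b := by
        field_simp [(hd b).ne']
      linarith
    obtain ⟨T, hT, hTv⟩ := exists_isTTransform d b a hab (δ / (v a - d a / d b * v b))
      (div_nonneg h0 (h0.trans hX)) (div_le_one_of_le₀ hX (h0.trans hX))
    refine ⟨T, hT, ?_⟩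
    rw [hTv, ← neg_sub (v a), mul_neg,
      div_mul_cancel_of_imp fun h => le_antisymm (hX.trans h.le) h0]
    ext w
    simp only [transfer_apply]
    split_ifs <;> ring

theorem ThermalReach.exists_list {n : ℕ} {d v v' : Fin n → ℝ} (hd : ∀ i, 0 < d i)
    (h : ThermalReach d v v') :
    ∃ L : List (Matrix (Fin n) (Fin n) ℝ), (∀ T ∈ L, IsTTransform d T) ∧ v' = L.prod *ᵥ v := by
  induction h with
  | refl => exact ⟨[], by simp, by simp⟩
  | tail _ hstep ih =>
    obtain ⟨L, hL, rfl⟩ := ih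
    obtain ⟨T, hT, rfl⟩ := hstep.exists_mulVec hd
    refine ⟨T :: L, ?_, by rw [List.prod_cons, Matrix.mulVec_mulVec]⟩
    simpa [hT] using hL

theorem ThermalReach.neg {ι : Type*} [DecidableEq ι] {d v v' : ι → ℝ} (h : ThermalReach d v v') :
    ThermalReach d (-v) (-v') := by
  refine Relation.ReflTransGen.lift (fun v => -v) ?_ _ _ h
  rintro v _ ⟨a, b, δ, h0, ha, hb, rfl⟩
  refine ⟨b, a, δ, h0, by simp only [Pi.neg_apply]; linarith,
    by simp only [Pi.neg_apply]; linarith, ?_⟩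
  ext w
  simp only [transfer_apply, Pi.neg_apply]
  ring

theorem ThermalReach.relabel {ι κ : Type*} [DecidableEq ι] [DecidableEq κ] (e : κ ≃ ι)
    {d v v' : ι → ℝ} (h : ThermalReach (d ∘ e) (v ∘ e) (v' ∘ e)) : ThermalReach d v v' := by
  have key := Relation.ReflTransGen.lift (p := ThermalMove d) (fun v => v ∘ e.symm) ?_ _ _ h
  · simpa [ThermalReach, Function.onFun, Function.comp_assoc] using key
  rintro v _ ⟨a, b, δ, h0, ha, hb, rfl⟩
  refine ⟨e a, e b, δ, h0, by simpa using ha, by simpa using hb, ?_⟩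
  ext w
  simp [transfer_apply, Equiv.symm_apply_eq]

theorem thermalReach_comp_swap {ι : Type*} [DecidableEq ι] {d : ι → ℝ}
    {a b : ι} (hab : d a = d b) (p : ι → ℝ) : ThermalReach d p (p ∘ Equiv.swap a b) := by
  refine Relation.ReflTransGen.single ?_
  wlog h : p b ≤ p a generalizing a b
  · rw [Equiv.swap_comm]
    exact this hab.symm (le_of_not_ge h)
  refine ⟨a, b, p a - p b, sub_nonneg.2 h, by rw [hab]; linarith, by rw [hab]; linarith, ?_⟩
  ext w
  simp only [Function.comp, transfer_apply, Equiv.swap_apply_def]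
  split_ifs with h1 h2 h2
  · rw [h1, ← h2, h1]; ring
  · rw [h1]; ring
  · rw [h2]; ring
  · ring

theorem thermalReach_comp_ofSubtype {ι : Type*} [Fintype ι] [DecidableEq ι] {d : ι → ℝ}
    {s : ι → Prop} [DecidablePred s] {c : ℝ} (hs : ∀ i, s i → d i = c)
    (f : Equiv.Perm {i // s i}) (p : ι → ℝ) :
    ThermalReach d p (p ∘ Equiv.Perm.ofSubtype f) := by
  induction f using Equiv.Perm.swap_induction_on generalizing p with
  | one => simpa [ThermalReach] using Relation.ReflTransGen.refl
  | swap_mul f x y _ ih =>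
    rw [map_mul, Equiv.Perm.ofSubtype_swap_eq, Equiv.Perm.coe_mul, ← Function.comp_assoc]
    exact (thermalReach_comp_swap (by rw [hs _ x.2, hs _ y.2]) p).trans (ih _)

theorem exists_perm_antitone {α β : Type*} [LinearOrder α] [Fintype α] [LinearOrder β]
    (f : α → β) : ∃ τ : Equiv.Perm α, Antitone (f ∘ τ) := by
  let e := Fintype.orderIsoFinOfCardEq α rfl
  let σ : Equiv.Perm (Fin (Fintype.card α)) := Tuple.sort (OrderDual.toDual ∘ f ∘ e)
  refine ⟨(e.symm.toEquiv.trans σ).trans e.toEquiv, fun x y hxy => ?_⟩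
  exact Tuple.monotone_sort (OrderDual.toDual ∘ f ∘ e) (e.symm.monotone hxy)

/-! ### Excess and thermo-majorization -/

/-- The total excess of `v` over the multiple `τ • d`. -/
def excess {ι : Type*} [Fintype ι] (d v : ι → ℝ) (τ : ℝ) : ℝ :=
  ∑ i, max (v i - τ * d i) 0

/-- The excess is the maximum over `A` of `v(A) - τ d(A)`; `excess_eq` says that superlevel sets of
`v i / d i` attain it. -/
theorem sum_le_excess {ι : Type*} [Fintype ι] (d v : ι → ℝ) (τ : ℝ) (A : Finset ι) :
    ∑ i ∈ A, v i - τ * ∑ i ∈ A, d i ≤ excess d v τ := by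
  rw [Finset.mul_sum, ← Finset.sum_sub_distrib]
  exact (Finset.sum_le_sum fun i _ => le_max_left _ _).trans
    (Finset.sum_le_sum_of_subset_of_nonneg (Finset.subset_univ A) fun i _ _ => le_max_right _ _)

theorem excess_eq {ι : Type*} [Fintype ι] {d v : ι → ℝ} {τ : ℝ} {A : Finset ι}
    (h1 : ∀ i ∈ A, τ * d i ≤ v i) (h2 : ∀ i, i ∉ A → v i ≤ τ * d i) :
    excess d v τ = ∑ i ∈ A, v i - τ * ∑ i ∈ A, d i := by
  rw [Finset.mul_sum, ← Finset.sum_sub_distrib, excess,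
    ← Finset.sum_subset (Finset.subset_univ A) fun i _ hi =>
      max_eq_right (sub_nonpos.2 (h2 i hi))]
  exact Finset.sum_congr rfl fun i hi => max_eq_left (sub_nonneg.2 (h1 i hi))

/-- `p` dominates `q` relative to `d` (thermo-majorization), in terms of excesses. -/
def ThermalDominates {ι : Type*} [Fintype ι] (d p q : ι → ℝ) : Prop :=
  (∀ (A : Finset ι) (τ : ℝ), ∑ i ∈ A, q i ≤ τ * ∑ i ∈ A, d i + excess d p τ) ∧
    ∑ i, q i = ∑ i, p i

/-- Apply the positive map `M`, which fixes `d` and preserves totals, to `p ≤ τ d + (p - τ d)⁺`. -/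
theorem IsDStochastic.thermalDominates {n : ℕ} {d : Fin n → ℝ} {M : Matrix (Fin n) (Fin n) ℝ}
    (hM : IsDStochastic d M) (p : Fin n → ℝ) : ThermalDominates d p (M *ᵥ p) := by
  refine ⟨fun A τ => ?_, Matrix.sum_mulVec_of_mem_colStochastic hM.1⟩
  set u : Fin n → ℝ := fun i => max (p i - τ * d i) 0 with hu
  have h0 : ∀ i, 0 ≤ (M *ᵥ u) i :=
    Matrix.nonneg_mulVec_of_mem_colStochastic hM.1 fun i => le_max_right _ _
  have h1 : ∀ i, (M *ᵥ p) i ≤ τ * d i + (M *ᵥ u) i := fun i => by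
    have := Matrix.nonneg_mulVec_of_mem_colStochastic hM.1 (x := u - (p - τ • d))
      (fun i => sub_nonneg.2 (le_max_left _ _)) i
    rw [Matrix.mulVec_sub, Matrix.mulVec_sub, Matrix.mulVec_smul, hM.2] at this
    simp only [Pi.sub_apply, Pi.smul_apply, smul_eq_mul] at this
    linarith
  calc ∑ i ∈ A, (M *ᵥ p) i ≤ ∑ i ∈ A, (τ * d i + (M *ᵥ u) i) := Finset.sum_le_sum fun i _ => h1 i
    _ = τ * ∑ i ∈ A, d i + ∑ i ∈ A, (M *ᵥ u) i := by rw [Finset.sum_add_distrib, Finset.mul_sum]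
    _ ≤ τ * ∑ i ∈ A, d i + ∑ i, (M *ᵥ u) i := by
      refine add_le_add le_rfl ?_
      exact Finset.sum_le_sum_of_subset_of_nonneg (Finset.subset_univ A) fun i _ _ => h0 i
    _ = _ := by rw [Matrix.sum_mulVec_of_mem_colStochastic hM.1]; rfl

theorem excess_comp {ι κ : Type*} [Fintype ι] [Fintype κ] (e : κ ≃ ι) (d v : ι → ℝ) (τ : ℝ) :
    excess (d ∘ e) (v ∘ e) τ = excess d v τ :=
  Equiv.sum_comp e fun i => max (v i - τ * d i) 0

theorem ThermalDominates.comp {ι κ : Type*} [Fintype ι] [Fintype κ] {d p q : ι → ℝ}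
    (h : ThermalDominates d p q) (e : κ ≃ ι) : ThermalDominates (d ∘ e) (p ∘ e) (q ∘ e) := by
  refine ⟨fun A τ => ?_, ?_⟩
  · simpa [excess_comp] using h.1 (A.map e.toEmbedding) τ
  · simpa [Equiv.sum_comp] using h.2

/-- Complementing `A` and negating `τ` exchanges excess and deficit, since the totals agree. -/
theorem ThermalDominates.neg {ι : Type*} [Fintype ι] {d p q : ι → ℝ}
    (h : ThermalDominates d p q) : ThermalDominates d (-p) (-q) := by
  classical
  refine ⟨fun A τ => ?_, by simpa using h.2⟩
  have h1 := h.1 Aᶜ (-τ)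
  have h2 : excess d (-p) τ = excess d p (-τ) - ∑ i, p i - τ * ∑ i, d i := by
    simp only [excess, Finset.mul_sum, ← Finset.sum_sub_distrib, Pi.neg_apply]
    refine Finset.sum_congr rfl fun i _ => ?_
    rcases max_cases (-p i - τ * d i) 0 with h | h <;>
      rcases max_cases (p i - -τ * d i) 0 with h' | h' <;> linarith
  have h3 := h.2
  rw [← Finset.sum_add_sum_compl A q] at h3
  have h4 := Finset.sum_add_sum_compl A d
  simp only [Pi.neg_apply, Finset.sum_neg_distrib]
  rw [h2, ← h4]
  linarith

/-! ### Sorting and Hardy–Littlewood–Pólya -/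

/-- A weighted form of the Hardy–Littlewood–Pólya theorem. -/
theorem thermalReach_of_sum_Iic_le {n : ℕ} {d p q : Fin n → ℝ} (hd : ∀ i, 0 < d i)
    (hq : ∀ i j, i ≤ j → d i * q j ≤ d j * q i)
    (hle : ∀ r, ∑ i ∈ Finset.Iic r, q i ≤ ∑ i ∈ Finset.Iic r, p i)
    (hsum : ∑ i, q i = ∑ i, p i) : ThermalReach d p q := by
  induction hN : (Finset.univ.filter fun i => p i ≠ q i).card using Nat.strong_induction_on
    generalizing p with
  | _ N ih =>
  by_cases hneg : ∃ j, p j < q j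
  swap
  · push Not at hneg
    have : q = p := by
      ext i
      exact (Finset.sum_eq_sum_iff_of_le fun i _ => hneg i).1 hsum i (Finset.mem_univ i)
    rw [this]
    exact Relation.ReflTransGen.refl
  obtain ⟨j, hj, hjmin⟩ : ∃ j, p j < q j ∧ ∀ i < j, q i ≤ p i := by
    obtain ⟨j, hj⟩ := WellFounded.has_min (wellFounded_lt (α := Fin n)) {j | p j < q j} hneg
    exact ⟨j, hj.1, fun i hi => not_lt.1 fun h => hj.2 i h hi⟩
  obtain ⟨i, hij, hi⟩ : ∃ i < j, q i < p i := by
    by_contra! hcon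
    have h1 : ∑ i ∈ Finset.Iic j, p i < ∑ i ∈ Finset.Iic j, q i := by
      refine Finset.sum_lt_sum (fun i hi => ?_) ⟨j, by simp, hj⟩
      rcases (Finset.mem_Iic.1 hi).eq_or_lt with rfl | h
      · exact hj.le
      · exact hcon i h
    exact (hle j).not_gt h1
  set δ := min (p i - q i) (q j - p j) with hδ
  have hδ0 : 0 < δ := lt_min (by linarith) (by linarith)
  have hδ1 : δ ≤ p i - q i := min_le_left _ _
  have hδ2 : δ ≤ q j - p j := min_le_right _ _
  -- After moving `δ`, level `i` still has at least `q i` and `j` at most `q j`; the order of `q`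
  -- then excludes overshooting.
  have hmove : d j * δ + d i * δ ≤ d j * p i - d i * p j := by
    have h1 := mul_le_mul_of_nonneg_left hδ1 (hd j).le
    have h2 := mul_le_mul_of_nonneg_left hδ2 (hd i).le
    linarith [hq i j hij.le]
  have hstep : ThermalMove d p (transfer p i j δ) :=
    ⟨i, j, δ, hδ0.le, by linarith [mul_pos (hd j) hδ0], by linarith [mul_pos (hd i) hδ0], rfl⟩
  refine Relation.ReflTransGen.head hstep (ih _ ?_ (fun r => ?_) ?_ rfl)
  · rw [← hN]
    refine Finset.card_lt_card ⟨fun w hw => ?_, fun hsub => ?_⟩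
    · simp only [Finset.mem_filter, Finset.mem_univ, true_and] at hw ⊢
      rcases eq_or_ne w i with rfl | hwi
      · exact hi.ne'
      rcases eq_or_ne w j with rfl | hwj
      · exact hj.ne
      simpa [transfer_apply, hwi, hwj] using hw
    · rcases min_choice (p i - q i) (q j - p j) with h | h
      · have := hsub (show i ∈ _ by simpa using hi.ne')
        simp [transfer_apply, hij.ne, hδ, h] at this
      · have := hsub (show j ∈ _ by simpa using hj.ne)
        simp [transfer_apply, hij.ne', hδ, h] at this
  · rw [sum_transfer]
    simp only [Finset.mem_Iic]
    have hr := hle r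
    split_ifs with h1 h2 h2
    · linarith
    -- No level before `j` is deficient, so the slack of this prefix is at least `p i - q i ≥ δ`.
    · have h3 := Finset.single_le_sum (f := fun w => p w - q w) (s := Finset.Iic r)
        (fun w hw => sub_nonneg.2 (hjmin w ((Finset.mem_Iic.1 hw).trans_lt (not_le.1 h2))))
        (Finset.mem_Iic.2 h1)
      rw [Finset.sum_sub_distrib] at h3
      linarith
    · exact absurd (hij.le.trans h2) h1
    · linarith
  · rw [sum_transfer]
    simpa using hsum

/-- A full swap of the level `k` with the level `j` just below it in the order of the ratios
`p i / d i` does not lower the excess curve on initial segments that do not separate them. -/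
theorem sum_le_excess_transfer {n : ℕ} {d p : Fin n → ℝ} {k j : Fin n} {c a τ₀ Q : ℝ}
    (hd : ∀ i, 0 < d i) (hjk : j < k) (hc : ∀ i, i ≠ k → d i = c) (hpk : p k = a * d k)
    (hpj : p j = τ₀ * c) (hlt : τ₀ < a)
    (hp : ∀ i i', i ≠ k → i' ≠ k → i ≤ i' → p i' ≤ p i) (hbig : ∀ i < j, a * c ≤ p i) (r : Fin n)
    (hQ : ∀ τ, Q ≤ τ * ∑ i ∈ Finset.Iic r, d i + excess d p τ) (τ : ℝ) :
    Q ≤ τ * ∑ i ∈ Finset.Iic r, d i + excess d (transfer p k j (p k - d k * τ₀)) τ := by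
  have hc0 : 0 < c := hc j hjk.ne ▸ hd j
  have hsame : ∀ A : Finset (Fin n), (k ∈ A ↔ j ∈ A) → (∀ i ∈ A, τ * d i ≤ p i) →
      (∀ i, i ∉ A → p i ≤ τ * d i) →
      -- A superlevel set containing both or neither of `k`, `j` keeps its sum. Only slopes strictly
      -- between `τ₀` and `a` remain; there the tangent of slope `a` serves `r < j` and that of
      -- slope `τ₀` serves `r ≥ j`.
      Q ≤ τ * ∑ i ∈ Finset.Iic r, d i + excess d (transfer p k j (p k - d k * τ₀)) τ := by
    intro A hA h1 h2
    refine (hQ τ).trans (add_le_add_right ?_ _)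
    refine le_trans (le_of_eq ?_) (sum_le_excess d _ τ A)
    rw [excess_eq h1 h2, sum_transfer]
    simp only [hA]
    ring
  rcases le_or_gt τ τ₀ with h1 | h1
  · refine hsame (Finset.univ.filter fun i => τ * d i ≤ p i) ?_ (by simp) ?_
    · have h2 : τ * d k ≤ p k := by
        rw [hpk]
        exact mul_le_mul_of_nonneg_right (h1.trans hlt.le) (hd k).le
      have h3 : τ * d j ≤ p j := by
        rw [hpj, hc j hjk.ne]
        exact mul_le_mul_of_nonneg_right h1 hc0.le
      simp [h2, h3]
    · intro i hi
      exact (not_le.1 (by simpa using hi)).le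
  rcases le_or_gt a τ with h2 | h2
  · refine hsame (Finset.univ.filter fun i => τ * d i < p i) ?_ ?_ (by simp)
    · have h2 : p k ≤ τ * d k := by
        rw [hpk]
        exact mul_le_mul_of_nonneg_right h2 (hd k).le
      have h3 : p j ≤ τ * d j := by
        rw [hpj, hc j hjk.ne]
        exact mul_le_mul_of_nonneg_right h1.le hc0.le
      simp [h2.not_gt, h3.not_gt]
    · intro i hi
      exact (by simpa using hi : _ < _).le
  rcases lt_or_ge r j with hr | hr
  · have hA : excess d p a =
        ∑ i ∈ Finset.Iio j, p i - a * ∑ i ∈ Finset.Iio j, d i := by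
      refine excess_eq (fun i hi => ?_) (fun i hi => ?_)
      · rw [Finset.mem_Iio] at hi
        rw [hc i (hi.trans hjk).ne]
        exact hbig i hi
      · rw [Finset.mem_Iio, not_lt] at hi
        rcases eq_or_ne i k with rfl | hik
        · exact hpk.le
        · rw [hc i hik]
          have := mul_lt_mul_of_pos_right hlt hc0
          linarith [hp j i hjk.ne hik hi]
    have hB := sum_le_excess d (transfer p k j (p k - d k * τ₀)) τ (Finset.Iio j)
    rw [sum_transfer] at hB
    simp only [Finset.mem_Iio, hjk.not_gt, lt_irrefl, if_false] at hB
    have hx : ∑ i ∈ Finset.Iic r, d i ≤ ∑ i ∈ Finset.Iio j, d i :=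
      Finset.sum_le_sum_of_subset_of_nonneg
        (fun i hi => Finset.mem_Iio.2 ((Finset.mem_Iic.1 hi).trans_lt hr)) fun i _ _ => (hd i).le
    have := hQ a
    nlinarith [mul_le_mul_of_nonneg_left hx (sub_nonneg.2 h2.le)]
  · have hkj : k ∉ Finset.Iic j := by simpa using hjk
    have hA : excess d p τ₀ =
        ∑ i ∈ insert k (Finset.Iic j), p i - τ₀ * ∑ i ∈ insert k (Finset.Iic j), d i := by
      refine excess_eq (fun i hi => ?_) (fun i hi => ?_)
      · rcases Finset.mem_insert.1 hi with rfl | hi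
        · rw [hpk]
          exact mul_le_mul_of_nonneg_right hlt.le (hd _).le
        · rw [Finset.mem_Iic] at hi
          have hik := (hi.trans_lt hjk).ne
          rw [hc i hik, ← hpj]
          exact hp i j hik hjk.ne hi
      · rw [Finset.mem_insert, Finset.mem_Iic, not_or, not_le] at hi
        rw [hc i hi.1, ← hpj]
        exact hp j i hjk.ne hi.1 hi.2.le
    rw [Finset.sum_insert hkj, Finset.sum_insert hkj] at hA
    have hB := sum_le_excess d (transfer p k j (p k - d k * τ₀)) τ (Finset.Iic j)
    rw [sum_transfer] at hB
    simp only [hkj, Finset.mem_Iic, le_refl, if_false, if_true] at hB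
    have hx : ∑ i ∈ Finset.Iic j, d i ≤ ∑ i ∈ Finset.Iic r, d i :=
      Finset.sum_le_sum_of_subset_of_nonneg (Finset.Iic_subset_Iic.2 hr) fun i _ _ => (hd i).le
    have := hQ τ₀
    nlinarith [mul_le_mul_of_nonneg_left hx (sub_nonneg.2 h1.le)]

/-- Here `k` can only be placed too late. Each full swap with the first level `j < k` of smaller
ratio hands that ratio to `k` and removes an inversion, until `p` is ordered like `q`. -/
theorem thermalReach_of_sorted_of_le {n : ℕ} {d p q : Fin n → ℝ} {k : Fin n} {c : ℝ}
    (hd : ∀ i, 0 < d i) (hkc : d k ≤ c) (hc : ∀ i, i ≠ k → d i = c)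
    (hq : ∀ i j, i ≤ j → d i * q j ≤ d j * q i) (hsum : ∑ i, q i = ∑ i, p i)
    (hdom : ∀ r τ, ∑ i ∈ Finset.Iic r, q i ≤ τ * ∑ i ∈ Finset.Iic r, d i + excess d p τ)
    (hp : ∀ i j, i ≠ k → j ≠ k → i ≤ j → p j ≤ p i)
    (hgt : ∀ i, k < i → d k * p i ≤ c * p k) : ThermalReach d p q := by
  induction hN : (Finset.univ.filter fun i => i < k ∧ d k * p i < c * p k).card
    using Nat.strong_induction_on generalizing p with
  | _ N ih =>
  have hk := hd k
  have hc0 : 0 < c := hk.trans_le hkc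
  by_cases hinv : ∃ j, j < k ∧ d k * p j < c * p k
  swap
  · push Not at hinv
    have hanti : ∀ i j, i ≤ j → d i * p j ≤ d j * p i := fun i j hij => by
      rcases eq_or_ne i k with rfl | hik <;> rcases eq_or_ne j i with rfl | hji
      · exact le_rfl
      · rw [hc j hji]
        exact hgt j (lt_of_le_of_ne hij hji.symm)
      · exact le_rfl
      · rcases eq_or_ne j k with rfl | hjk
        · rw [hc i hik]
          exact hinv i (lt_of_le_of_ne hij hji.symm)
        · rw [hc i hik, hc j hjk]
          exact mul_le_mul_of_nonneg_left (hp i j hik hjk hij) hc0.le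
    refine thermalReach_of_sum_Iic_le hd hq (fun r => ?_) hsum
    -- With `p` sorted, the slope `p r / d r` is tangent at the vertex of `Iic r`.
    have h1 : excess d p (p r / d r) =
        ∑ i ∈ Finset.Iic r, p i - p r / d r * ∑ i ∈ Finset.Iic r, d i := by
      refine excess_eq (fun i hi => ?_) (fun i hi => ?_)
      · rw [div_mul_eq_mul_div, div_le_iff₀ (hd r)]
        linarith [hanti i r (Finset.mem_Iic.1 hi)]
      · rw [div_mul_eq_mul_div, le_div_iff₀ (hd r)]
        linarith [hanti r i (not_le.1 fun h => hi (Finset.mem_Iic.2 h)).le]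
    linarith [hdom r (p r / d r)]
  obtain ⟨j, ⟨hjk, hj⟩, hjmin⟩ : ∃ j, (j < k ∧ d k * p j < c * p k) ∧
      ∀ i < j, c * p k ≤ d k * p i := by
    obtain ⟨j, hj⟩ := WellFounded.has_min (wellFounded_lt (α := Fin n))
      {j | j < k ∧ d k * p j < c * p k} hinv
    exact ⟨j, hj.1, fun i hi => not_lt.1 fun h => hj.2 i ⟨hi.trans hj.1.1, h⟩ hi⟩
  obtain ⟨a, hpk⟩ : ∃ a, p k = a * d k := ⟨p k / d k, (div_mul_cancel₀ _ hk.ne').symm⟩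
  obtain ⟨τ₀, hpj⟩ : ∃ τ₀, p j = τ₀ * c := ⟨p j / c, (div_mul_cancel₀ _ hc0.ne').symm⟩
  have hlt : τ₀ < a := by
    rw [hpk, hpj] at hj
    have h1 : (d k * c) * τ₀ < (d k * c) * a := by linarith
    exact lt_of_mul_lt_mul_left h1 (by positivity)
  have hbig : ∀ i < j, a * c ≤ p i := fun i hi => by
    have h1 := hjmin i hi
    rw [hpk] at h1
    have h2 : d k * (a * c) ≤ d k * p i := by linarith
    exact le_of_mul_le_mul_left h2 hk
  have hδ0 : 0 < p k - d k * τ₀ := by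
    rw [hpk]
    nlinarith
  set p' := transfer p k j (p k - d k * τ₀) with hp'
  have hp'k : p' k = d k * τ₀ := by
    simp [hp', transfer_apply, hjk.ne']
  have hp'j : p' j = p j + (p k - d k * τ₀) := by
    simp [hp', transfer_apply, hjk.ne]
  have hp'o : ∀ i, i ≠ k → i ≠ j → p' i = p i := fun i h1 h2 => by
    simp [hp', transfer_apply, h1, h2]
  have hp'j_le : p' j ≤ a * c := by
    rw [hp'j, hpj, hpk]
    nlinarith [mul_le_mul_of_nonneg_right hkc (sub_nonneg.2 hlt.le)]
  have hstep : ThermalMove d p p' := by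
    have h1 : (p k - d k * τ₀) * c = c * p k - d k * p j := by rw [hpj]; ring
    refine ⟨k, j, p k - d k * τ₀, hδ0.le, ?_, ?_, rfl⟩
    · rw [hc j hjk.ne, ← h1]
      -- The full swap is admissible because `d k ≤ c`.
      exact mul_le_mul_of_nonneg_left hkc hδ0.le
    · rw [hc j hjk.ne, ← h1]
  refine Relation.ReflTransGen.head hstep (ih _ ?_ ?_ (fun r τ => ?_) ?_ ?_ rfl)
  · rw [← hN]
    refine Finset.card_lt_card ⟨fun w hw => ?_, fun hsub => ?_⟩
    · simp only [Finset.mem_filter, Finset.mem_univ, true_and] at hw ⊢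
      obtain ⟨hwk, hw⟩ := hw
      rcases eq_or_ne w j with rfl | hwj
      · exact ⟨hwk, hj⟩
      rw [hp'o w hwk.ne hwj, hp'k] at hw
      refine ⟨hwk, ?_⟩
      rw [hpj] at hj
      linarith
    · have h1 := hsub (show j ∈ _ by simpa using ⟨hjk, hj⟩)
      simp only [Finset.mem_filter, Finset.mem_univ, true_and] at h1
      have h2 := h1.2
      rw [hp'j, hp'k, hpj] at h2
      linarith [mul_pos hk hδ0]
  · rw [hp', sum_transfer]
    simpa using hsum
  · exact sum_le_excess_transfer hd hjk hc hpk hpj hlt hp hbig r (hdom r) τ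
  · intro i i' hik hi'k hii'
    rcases eq_or_ne i j with rfl | hij <;> rcases eq_or_ne i' i with rfl | hi'i
    · exact le_rfl
    · rw [hp'o i' hi'k hi'i, hp'j]
      linarith [hp i i' hik hi'k hii']
    · exact le_rfl
    · rw [hp'o i hik hij]
      rcases eq_or_ne i' j with rfl | hi'j
      · exact hp'j_le.trans (hbig i (lt_of_le_of_ne hii' hij))
      · rw [hp'o i' hi'k hi'j]
        exact hp i i' hik hi'k hii'
  · intro i hki
    rw [hp'o i hki.ne' (hjk.trans hki).ne', hp'k]
    have h1 := hp j i hjk.ne hki.ne' (hjk.trans hki).le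
    rw [hpj] at h1
    linarith [mul_le_mul_of_nonneg_left h1 hk.le]

theorem thermalReach_of_sorted {n : ℕ} {d p q : Fin n → ℝ} {k : Fin n} {c : ℝ}
    (hd : ∀ i, 0 < d i) (hkc : d k ≤ c) (hc : ∀ i, i ≠ k → d i = c)
    (hq : ∀ i j, i ≤ j → d i * q j ≤ d j * q i) (hdom : ThermalDominates d p q)
    (hp : ∀ i j, i ≠ k → j ≠ k → i ≤ j → p j ≤ p i) : ThermalReach d p q := by
  by_cases hgt : ∀ i, k < i → d k * p i ≤ c * p k
  · exact thermalReach_of_sorted_of_le hd hkc hc hq hdom.2 (fun r τ => hdom.1 _ τ) hp hgt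
  push Not at hgt
  obtain ⟨i₀, hki₀, hi₀⟩ := hgt
  -- Otherwise `k` is placed too early; reversing the order and negating the vectors reduces to the
  -- previous case. No positivity of `p` or `q` is needed.
  have hdom' := (hdom.comp Fin.revPerm).neg
  have hne : ∀ i : Fin n, i ≠ k.rev → i.rev ≠ k := fun i hi h => hi (by rw [← h, Fin.rev_rev])
  have key : ThermalReach (d ∘ Fin.revPerm) (-(p ∘ Fin.revPerm)) (-(q ∘ Fin.revPerm)) := by
    refine thermalReach_of_sorted_of_le (k := k.rev) (c := c) (fun i => hd _)
      (by simpa using hkc) (fun i hi => hc _ (hne i hi)) (fun i j hij => ?_) hdom'.2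
      (fun r τ => hdom'.1 _ τ) (fun i j hi hj hij => ?_) (fun i hi => ?_)
    · have := hq _ _ (Fin.rev_le_rev.2 hij)
      simp only [Function.comp, Pi.neg_apply, Fin.revPerm_apply]
      linarith
    · simpa using hp _ _ (hne j hj) (hne i hi) (Fin.rev_le_rev.2 hij)
    · have hik : i.rev < k := by rwa [← Fin.rev_lt_iff] at hi
      have h1 := hp i.rev i₀ hik.ne hki₀.ne' (hik.trans hki₀).le
      have h2 := mul_le_mul_of_nonneg_left h1 (hd k).le
      simp only [Function.comp, Pi.neg_apply, Fin.revPerm_apply, Fin.rev_rev]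
      linarith
  simpa using (ThermalReach.relabel (v := -p) (v' := -q) Fin.revPerm key).neg

/-- Relabelling sorts `q i / d i`; permuting levels of equal weight then sorts `p` away from `k`
without changing its excess. -/
theorem ThermalDominates.thermalReach {n : ℕ} {d p q : Fin n → ℝ} {k : Fin n} {c : ℝ}
    (hd : ∀ i, 0 < d i) (hkc : d k ≤ c) (hc : ∀ i, i ≠ k → d i = c)
    (hdom : ThermalDominates d p q) : ThermalReach d p q := by
  obtain ⟨e, he⟩ := exists_perm_antitone fun i => q i / d i
  refine ThermalReach.relabel e ?_
  set k' := e.symm k with hk'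
  have hek : e k' = k := e.apply_symm_apply k
  have hc' : ∀ i, i ≠ k' → (d ∘ e) i = c := fun i hi =>
    hc _ fun h => hi (by rw [hk', ← h, e.symm_apply_apply])
  obtain ⟨f, hf⟩ := exists_perm_antitone fun i : {i // i ≠ k'} => p (e i)
  have hperm : d ∘ e ∘ Equiv.Perm.ofSubtype f = d ∘ e := by
    ext i
    by_cases hi : i = k'
    · simp only [Function.comp]
      rw [Equiv.Perm.ofSubtype_apply_of_not_mem f (by simpa using hi)]
    · rw [hc' i hi]
      refine hc' _ ?_
      rw [Equiv.Perm.ofSubtype_apply_of_mem f hi]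
      exact (f ⟨i, hi⟩).2
  refine (thermalReach_comp_ofSubtype hc' f (p ∘ e)).trans ?_
  refine thermalReach_of_sorted (k := k') (c := c) (fun i => hd _) (by simpa [hek] using hkc) hc'
    (fun i j hij => ?_) ?_ (fun i j hi hj hij => ?_)
  · have := he hij
    simp only [Function.comp] at this ⊢
    rw [div_le_div_iff₀ (hd _) (hd _)] at this
    linarith
  · refine ⟨fun A τ => ?_, ?_⟩
    · have h1 := (hdom.comp e).1 A τ
      rwa [← excess_comp (Equiv.Perm.ofSubtype f) (d ∘ e) (p ∘ e), Function.comp_assoc,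
        hperm] at h1
    · rw [(hdom.comp e).2]
      exact (Equiv.sum_comp (Equiv.Perm.ofSubtype f) (p ∘ e)).symm
  · have := hf (show (⟨i, hi⟩ : {i // i ≠ k'}) ≤ ⟨j, hj⟩ from hij)
    simp only [Function.comp] at this ⊢
    rwa [Equiv.Perm.ofSubtype_apply_of_mem f hi, Equiv.Perm.ofSubtype_apply_of_mem f hj]

/-! ### The equivalence -/

theorem resourceTO_eq_of_downArrangement {n : ℕ} {d : Fin n → ℝ} (hn : 0 < n)
    (hpos : ∀ i, 0 < d i) {d₀ d₁ : ℝ}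
    (h : ∀ k : Fin n, downArrangement d k = if (k : ℕ) + 1 = n then d₁ else d₀) :
    resourceTO d = resourceWETO d := by
  refine Set.Subset.antisymm ?_ (resourceWETO_subset_resourceTO hpos)
  rintro ⟨p, q⟩ ⟨hp, hq, M, hM, hqM⟩
  refine ⟨hp, hq, ?_⟩
  simp only at hqM ⊢
  set σ : Equiv.Perm (Fin n) := Tuple.sort (fun i => -d i) with hσ
  have hd : ∀ i, d i = downArrangement d (σ.symm i) := fun i => by
    simp [downArrangement, ← hσ]
  set l : Fin n := ⟨n - 1, by omega⟩ with hl
  have hlast : ∀ m : Fin n, m ≠ l → downArrangement d m = d₀ := fun m hm => by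
    rw [h, if_neg]
    rw [hl, Ne, Fin.ext_iff] at hm
    simp only at hm
    omega
  have hmin : ∀ i, d (σ l) ≤ d i := fun i => by
    rw [hd i, hd (σ l), σ.symm_apply_apply]
    refine downArrangement_antitone d ?_
    rw [Fin.le_def]
    simp only [hl]
    omega
  have hother : ∀ i, i ≠ σ l → d i = d₀ := fun i hi => by
    rw [hd i]
    exact hlast _ fun h => hi (by rw [← h, σ.apply_symm_apply])
  -- For `n = 1` the value `d₀` is unconstrained and may lie below `d (σ l)`, so another `c` is
  -- needed.
  obtain ⟨c, hkc, hc⟩ : ∃ c, d (σ l) ≤ c ∧ ∀ i, i ≠ σ l → d i = c := by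
    by_cases hex : ∃ i, i ≠ σ l
    · obtain ⟨i, hi⟩ := hex
      exact ⟨d₀, hother i hi ▸ hmin i, hother⟩
    · push Not at hex
      exact ⟨d (σ l), le_rfl, fun i hi => absurd (hex i) hi⟩
  subst hqM
  exact ((hM.thermalDominates p).thermalReach hpos hkc hc).exists_list hpos

theorem mainTheorem2 (n : ℕ) (d : Fin n → ℝ) (hd : d ∈ stdSimplex ℝ (Fin n))
    (hpos : ∀ i, 0 < d i) :
    resourceTO d = resourceWETO d ↔
      ∃ d₀ d₁ : ℝ, ∀ k : Fin n, downArrangement d k = if (k : ℕ) + 1 = n then d₁ else d₀ := by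
  refine ⟨downArrangement_eq_of_resourceTO_eq hd.2 hpos, fun ⟨d₀, d₁, h⟩ => ?_⟩
  refine resourceTO_eq_of_downArrangement (Nat.pos_of_ne_zero ?_) hpos h
  rintro rfl
  simpa using hd.2
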